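/- For $x\in(0,1)$ let $h(x)=\left(x^x(1-x)^{1-x}\right)^{-1}$, let $$G(a,b,c,d)=\frac{h\left(\frac{a+b+c+d}{2}\right)^2 h\left(\frac{10a}{3}\right)^{3/10} h\left(\frac{10b}{7}\right)^{7/10} h\left(\frac{5c}{3}\right)^{3/5} h\left(\frac{5d}{2}\right)^{2/5}}{h\left(\frac{10(a+c)}{9}\right)^{9/10} h\left(\frac{10(b+d)}{11}\right)^{11/10} h(a+b)\,h(c+d)},$$ and let $g=\log G$. For $(u,v)\in\Omega:=(0,\frac3{10})\times(\frac35,1)$ let $$k(u,v)=\frac{1}{v-u}\Bigl(u(v-\tfrac3{10}),\ (1-u)(v-\tfrac3{10}),\ u(v-\tfrac35),\ (1-u)(v-\tfrac35)\Bigr).$$ Then $g$ is twice continuously differentiable near each $k(u,v)$, $(u,v)\in\Omega$, and the eigenvalues of its Hessian $H(u,v)=g''(k(u,v))$, with multiplicity, are $0,0,\lambda_1(u,v),\lambda_2(u,v)$, where $\lambda_1\le\lambda_2$ are continuous functions on $\Omega$ that are negative and bounded away from $0$: there is $c>0$ with $\lambda_1\le\lambda_2\le -c$ on $\Omega$. Moreover,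 their behaviour at the boundary is as follows (all limits are taken within $\Omega$). Edges. In each line below $C$ and $C'$ denote continuous negative functions, which may differ from line to line. - As $(u,v)\to(0,v_0)$, $v_0\in(\frac35,1)$: $\lambda_1=(1+o(1))\frac{C(v_0)}{u}$ and $\lambda_2\to C'(v_0)$. - As $(u,v)\to(\frac3{10},v_0)$, $v_0\in(\frac35,1)$: $\lambda_1=(1+o(1))\frac{C(v_0)}{3/10-u}$ and $\lambda_2\to C'(v_0)$. - As $(u,v)\to(u_0,\frac35)$, $u_0\in(0,\frac3{10})$: $\lambda_1=(1+o(1))\frac{C(u_0)}{v-3/5}$ and $\lambda_2\to C'(u_0)$. - As $(u,v)\to(u_0,1)$, $u_0\in(0,\frac3{10})$: $\lambda_1=(1+o(1))\frac{C(u_0)}{1-v}$ and $\lambda_2\to C'(u_0)$. Corners. Let $(\mu,\nu)\downarrow(0,0)$. At each corner there are negative constants $C,C'$, which may differ from corner to corner, such that - at $(u,v)=(\mu,\frac35+\nu)$ and at $(u,v)=(\frac3{10}-\mu,1-\nu)$: $\lambda_1=(1+o(1))\frac{C}{\mu\nu}$ and $\lambda_2\to C'$; - at $(u,v)=(\mu,1-\nu)$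 and at $(u,v)=(\frac3{10}-\mu,\frac35+\nu)$: $\lambda_1=(1+o(1))\min\left(\frac C\mu,\frac{C'}\nu\right)$ and $\lambda_2=(1+o(1))\max\left(\frac C\mu,\frac{C'}\nu\right)$; in particular $\lambda_1$ is of order $-1/\min(\mu,\nu)$ and $\lambda_2$ of order $-1/\max(\mu,\nu)$. -/

import Mathlib

open Set Filter Topology

namespace LDAHessian

/-- `h x = (x ^ x * (1 - x) ^ (1 - x))⁻¹`, used for `0 < x < 1`. -/
noncomputable def h (x : ℝ) : ℝ := (x ^ x * (1 - x) ^ (1 - x))⁻¹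

/-- The function `G(a, b, c, d)`, with `(a, b, c, d) = (x 0, x 1, x 2, x 3)`. -/
noncomputable def G (x : Fin 4 → ℝ) : ℝ :=
  (h ((x 0 + x 1 + x 2 + x 3) / 2) ^ (2 : ℝ)
      * h (10 * x 0 / 3) ^ (3 / 10 : ℝ) * h (10 * x 1 / 7) ^ (7 / 10 : ℝ)
      * h (5 * x 2 / 3) ^ (3 / 5 : ℝ) * h (5 * x 3 / 2) ^ (2 / 5 : ℝ))
    / (h (10 * (x 0 + x 2) / 9) ^ (9 / 10 : ℝ) * h (10 * (x 1 + x 3) / 11) ^ (11 / 10 : ℝ)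
      * h (x 0 + x 1) * h (x 2 + x 3))

/-- `g = log G`. -/
noncomputable def g (x : Fin 4 → ℝ) : ℝ := Real.log (G x)

/-- The parametrisation `(u, v) ↦ k(u, v)` of the surface `Π`. -/
noncomputable def k (p : ℝ × ℝ) : Fin 4 → ℝ :=
  ![p.1 * (p.2 - 3 / 10) / (p.2 - p.1),
    (1 - p.1) * (p.2 - 3 / 10) / (p.2 - p.1),
    p.1 * (p.2 - 3 / 5) / (p.2 - p.1),
    (1 - p.1) * (p.2 - 3 / 5) / (p.2 - p.1)]

/-- The open parameter domain `(0, 3/10) × (3/5, 1)`. -/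
def domain : Set (ℝ × ℝ) := Ioo (0 : ℝ) (3 / 10) ×ˢ Ioo (3 / 5 : ℝ) 1

/-- The matrix of second partial derivatives of `f` at `x`. -/
noncomputable def hessian (f : (Fin 4 → ℝ) → ℝ) (x : Fin 4 → ℝ) : Matrix (Fin 4) (Fin 4) ℝ :=
  Matrix.of fun i j =>
    fderiv ℝ (fun y => fderiv ℝ f y (Pi.single j 1)) x (Pi.single i 1)

/-- `H(u, v)`, the Hessian of `g` at the point `k(u, v)`. -/
noncomputable def H (p : ℝ × ℝ) : Matrix (Fin 4) (Fin 4) ℝ := hessian g (k p)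

/-- For `t` in `I`, `F(u, v)` tends to `C t` as `(u, v)` tends to the boundary point `e t` inside the
domain, where `C` is a continuous negative function on `I`. -/
def HasEdgeLimit (F : ℝ × ℝ → ℝ) (I : Set ℝ) (e : ℝ → ℝ × ℝ) : Prop :=
  ∃ C : ℝ → ℝ, ContinuousOn C I ∧
    ∀ t ∈ I, C t < 0 ∧ Tendsto F (𝓝[domain] (e t)) (𝓝 (C t))

/-- The filter `(μ, ν) ↓ (0, 0)`. -/
def toCorner : Filter (ℝ × ℝ) := 𝓝[>] (0 : ℝ) ×ˢ 𝓝[>] (0 : ℝ)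

/-- Behaviour at a corner: `E₁(μ, ν) = (1 + o(1)) C / (μ ν)` and `E₂(μ, ν) → C'` for negative
constants `C` and `C'`. -/
def HasProductCorner (E₁ E₂ : ℝ × ℝ → ℝ) : Prop :=
  (∃ C < 0, Tendsto (fun q => q.1 * q.2 * E₁ q) toCorner (𝓝 C)) ∧
    ∃ C' < 0, Tendsto E₂ toCorner (𝓝 C')

/-- Behaviour at a corner: `E₁(μ, ν) = (1 + o(1)) min (C / μ) (C' / ν)` and
`E₂(μ, ν) = (1 + o(1)) max (C / μ) (C' / ν)` for negative constants `C` and `C'`. -/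
def HasMinMaxCorner (E₁ E₂ : ℝ × ℝ → ℝ) : Prop :=
  ∃ C < 0, ∃ C' < 0,
    Tendsto (fun q => E₁ q / min (C / q.1) (C' / q.2)) toCorner (𝓝 1) ∧
      Tendsto (fun q => E₂ q / max (C / q.1) (C' / q.2)) toCorner (𝓝 1)

end LDAHessian

/-!
The logarithm of `h` is the binary entropy, so `g` is a signed sum of nine terms `w * η (ℓ / w)`,
where `η` is the binary entropy and `ℓ` is a marginal (entry, row sum, column sum or total) of the
table with rows `(a, b)` and `(c, d)`. The second derivative of such a term in `ℓ` is
`-(1 / ℓ + 1 / (w - ℓ))` (`hessian_entropySum`).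

At `k (u, v)` both the table of the `ℓ` and the complementary table of the `w - ℓ` are of product
form, with column distributions `(u, 1 - u)` and `(v, 1 - v)`. For a table of product form, the
chi-square forms of entries and margins combine to a form that only sees the interaction contrast,
hence of rank one (`sum_coeffs_div_productMargins`). So the Hessian is
`-(α A Aᵀ + β B Bᵀ)` for two explicit vectors (`H_apply`), which gives the eigenvalue `0` twice and
two more eigenvalues given by the Gram matrix of `√α A` and `√β B` (`roots_charpoly_of_rank_two`).

The coefficient `α` has its poles on the edges `u = 0`, `v = 3/5`, through the factor
`mA = u (v - 3/5)`, and `β` on the other two edges, through `mB = (3/10 - u) (1 - v)`. With the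
poles removed, trace and determinant of the Gram matrix are `trc / (mA mB)` and
`gramDet / (mA mB)`, where `trc` and `gramDet` are continuous on the closed rectangle and `gramDet`
is positive there. Writing the eigenvalues as `-bigRoot / (mA mB)` and `-gramDet / bigRoot`, all
claims except those at the corners `(0, 1)` and `(3/10, 3/5)` follow from continuity, as `bigRoot`
vanishes only at these two. At these two corners `A` and `B` are orthogonal, so that the two rank
one parts decouple asymptotically (`tendsto_eig_div`).
-/

/-! ### Second derivatives of sums of entropies of linear forms -/

namespace LDAHessian

section EntropySum

variable {ι : Type*} [Fintype ι]

/-- The linear form on `ℝ⁴` with coefficient vector `c`. -/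
noncomputable def linForm (c : Fin 4 → ℝ) : (Fin 4 → ℝ) →L[ℝ] ℝ :=
  ∑ i, c i • ContinuousLinearMap.proj (R := ℝ) i

lemma linForm_apply (c x : Fin 4 → ℝ) : linForm c x = ∑ i, c i * x i := by
  simp [linForm]

lemma linForm_single (c : Fin 4 → ℝ) (j : Fin 4) : linForm c (Pi.single j 1) = c j := by
  simp [linForm_apply, Pi.single_apply]

/-- The signed sum `∑ t, s t * (w t * η (ℓ t x / w t))`, with `η` the binary entropy and `ℓ t` the
linear form with coefficients `L t`. -/
noncomputable def entropySum (s w : ι → ℝ) (L : ι → Fin 4 → ℝ) (x : Fin 4 → ℝ) : ℝ :=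
  ∑ t, s t * (w t * Real.binEntropy (linForm (L t) x / w t))

/-- The open set on which all the entropies in `entropySum` are taken at points of `(0, 1)`. -/
def entropyRegion (w : ι → ℝ) (L : ι → Fin 4 → ℝ) : Set (Fin 4 → ℝ) :=
  {x | ∀ t, 0 < linForm (L t) x ∧ linForm (L t) x < w t}

lemma isOpen_entropyRegion (w : ι → ℝ) (L : ι → Fin 4 → ℝ) : IsOpen (entropyRegion w L) := by
  simp only [entropyRegion, ofPred_forall]
  exact isOpen_iInter_of_finite fun t =>
    (isOpen_lt continuous_const (linForm (L t)).continuous).inter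
      (isOpen_lt (linForm (L t)).continuous continuous_const)

lemma hasFDerivAt_entropySum {s w : ι → ℝ} {L : ι → Fin 4 → ℝ} {x : Fin 4 → ℝ}
    (hx : x ∈ entropyRegion w L) :
    HasFDerivAt (entropySum s w L)
      (∑ t, (s t * (Real.log (w t - linForm (L t) x) - Real.log (linForm (L t) x))) •
        linForm (L t)) x := by
  refine HasFDerivAt.fun_sum fun t _ => ?_
  obtain ⟨h0, h1⟩ := hx t
  have hw : 0 < w t := h0.trans h1
  have hlt : linForm (L t) x / w t < 1 := (div_lt_one hw).2 h1
  have hd := (Real.hasDerivAt_binEntropy (p := linForm (L t) x / w t) (by positivity)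
    hlt.ne).comp_hasFDerivAt x ((linForm (L t)).hasFDerivAt.mul_const (w t)⁻¹)
  refine ((hd.const_mul (w t)).const_mul (s t)).congr_fderiv ?_
  have e : 1 - linForm (L t) x / w t = (w t - linForm (L t) x) / w t := by field_simp
  rw [e, Real.log_div (sub_pos.2 h1).ne' hw.ne', Real.log_div h0.ne' hw.ne']
  ext v
  simp
  field_simp

lemma contDiffAt_entropySum {s w : ι → ℝ} {L : ι → Fin 4 → ℝ} {x : Fin 4 → ℝ}
    (hx : x ∈ entropyRegion w L) : ContDiffAt ℝ 2 (entropySum s w L) x := by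
  refine ContDiffAt.sum fun t _ => contDiffAt_const.mul (contDiffAt_const.mul ?_)
  obtain ⟨h0, h1⟩ := hx t
  have hw : 0 < w t := h0.trans h1
  have hlt : linForm (L t) x / w t < 1 := (div_lt_one hw).2 h1
  have hpos : 0 < linForm (L t) x / w t := by positivity
  have hl : ContDiffAt ℝ 2 (fun y => linForm (L t) y / w t) x :=
    (linForm (L t)).contDiff.contDiffAt.div_const _
  simp only [Real.binEntropy, Real.log_inv]
  exact (hl.mul (hl.log hpos.ne').neg).add
    ((contDiffAt_const.sub hl).mul ((contDiffAt_const.sub hl).log (sub_pos.2 hlt).ne').neg)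

lemma hessian_entropySum {s w : ι → ℝ} {L : ι → Fin 4 → ℝ} {x : Fin 4 → ℝ}
    (hx : x ∈ entropyRegion w L) (i j : Fin 4) :
    hessian (entropySum s w L) x i j =
      ∑ t, -(s t * (L t i * L t j)) *
        (1 / linForm (L t) x + 1 / (w t - linForm (L t) x)) := by
  have hev : (fun y => fderiv ℝ (entropySum s w L) y (Pi.single j 1)) =ᶠ[𝓝 x]
      fun y => ∑ t, s t * (Real.log (w t - linForm (L t) y) - Real.log (linForm (L t) y)) *
        L t j := by
    filter_upwards [(isOpen_entropyRegion w L).mem_nhds hx] with y hy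
    simp [(hasFDerivAt_entropySum hy).fderiv, linForm_single]
  have hd : HasFDerivAt
      (fun y => ∑ t, s t * (Real.log (w t - linForm (L t) y) - Real.log (linForm (L t) y)) *
        L t j)
      (∑ t, (-(s t * L t j) * (1 / linForm (L t) x + 1 / (w t - linForm (L t) x))) •
        linForm (L t)) x := by
    refine HasFDerivAt.fun_sum fun t _ => ?_
    obtain ⟨h0, h1⟩ := hx t
    have hl := (linForm (L t)).hasFDerivAt (x := x)
    have h2 := (((hl.const_sub (w t)).log (sub_pos.2 h1).ne').fun_sub (hl.log h0.ne')).const_mul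
      (s t) |>.mul_const (L t j)
    refine h2.congr_fderiv ?_
    ext v
    simp
    ring
  simp only [hessian, Matrix.of_apply]
  rw [hev.fderiv_eq, hd.fderiv]
  simp only [sum_apply, smul_apply, linForm_single,
    smul_eq_mul]
  exact Finset.sum_congr rfl fun t _ => by ring

end EntropySum

lemma hessian_congr {f₁ f₂ : (Fin 4 → ℝ) → ℝ} {x : Fin 4 → ℝ} (hf : f₁ =ᶠ[𝓝 x] f₂) :
    hessian f₁ x = hessian f₂ x := by
  ext i j
  have h1 : (fun y => fderiv ℝ f₁ y (Pi.single j 1)) =ᶠ[𝓝 x]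
      fun y => fderiv ℝ f₂ y (Pi.single j 1) := by
    filter_upwards [hf.fderiv (𝕜 := ℝ)] with y hy
    rw [hy]
  simp only [hessian, Matrix.of_apply]
  rw [h1.fderiv_eq]

/-! ### The function `g` as a sum of entropies -/

lemma h_pos {x : ℝ} (h0 : 0 < x) (h1 : x < 1) : 0 < h x := by
  have := sub_pos.2 h1
  unfold h
  positivity

lemma log_h {x : ℝ} (h0 : 0 < x) (h1 : x < 1) : Real.log (h x) = Real.binEntropy x := by
  have := sub_pos.2 h1
  rw [h, Real.log_inv, Real.log_mul (by positivity) (by positivity), Real.log_rpow h0,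
    Real.log_rpow this, Real.binEntropy, Real.log_inv, Real.log_inv]
  ring

/-- Signs of the nine entropies in `g`. -/
def sgn : Fin 9 → ℝ := ![1, 1, 1, 1, 1, -1, -1, -1, -1]

/-- Weights of the nine entropies in `g`. -/
noncomputable def wt : Fin 9 → ℝ := ![2, 3 / 10, 7 / 10, 3 / 5, 2 / 5, 9 / 10, 11 / 10, 1, 1]

/-- Coefficients of the nine linear forms in `g`: the total, the four entries, the two column sums
and the two row sums of the table with rows `(a, b)` and `(c, d)`. -/
def coeffs : Fin 9 → Fin 4 → ℝ :=
  ![![1, 1, 1, 1], ![1, 0, 0, 0], ![0, 1, 0, 0], ![0, 0, 1, 0], ![0, 0, 0, 1],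
    ![1, 0, 1, 0], ![0, 1, 0, 1], ![1, 1, 0, 0], ![0, 0, 1, 1]]

lemma g_eq_entropySum {x : Fin 4 → ℝ} (hx : x ∈ entropyRegion wt coeffs) :
    g x = entropySum sgn wt coeffs x := by
  have key : ∀ t (e : ℝ), 0 < h (linForm (coeffs t) x / wt t) ^ e ∧
      Real.log (h (linForm (coeffs t) x / wt t) ^ e) =
        e * Real.binEntropy (linForm (coeffs t) x / wt t) := by
    intro t e
    obtain ⟨h0, h1⟩ := hx t
    have h2 : 0 < linForm (coeffs t) x / wt t := div_pos h0 (h0.trans h1)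
    have h3 : linForm (coeffs t) x / wt t < 1 := (div_lt_one (h0.trans h1)).2 h1
    exact ⟨Real.rpow_pos_of_pos (h_pos h2 h3) e, by rw [Real.log_rpow (h_pos h2 h3), log_h h2 h3]⟩
  have hG : G x = (h (linForm (coeffs 0) x / wt 0) ^ wt 0 * h (linForm (coeffs 1) x / wt 1) ^ wt 1
      * h (linForm (coeffs 2) x / wt 2) ^ wt 2 * h (linForm (coeffs 3) x / wt 3) ^ wt 3
      * h (linForm (coeffs 4) x / wt 4) ^ wt 4)
      / (h (linForm (coeffs 5) x / wt 5) ^ wt 5 * h (linForm (coeffs 6) x / wt 6) ^ wt 6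
      * h (linForm (coeffs 7) x / wt 7) ^ wt 7 * h (linForm (coeffs 8) x / wt 8) ^ wt 8) := by
    simp only [G, linForm_apply, Fin.sum_univ_four]
    simp [coeffs, wt]
    ring_nf
  have hp : ∀ t, h (linForm (coeffs t) x / wt t) ^ wt t ≠ 0 := fun t => (key t _).1.ne'
  rw [g, hG, Real.log_div (by simp [hp]) (by simp [hp]), Real.log_mul (by simp [hp]) (hp _),
    Real.log_mul (by simp [hp]) (hp _), Real.log_mul (by simp [hp]) (hp _),
    Real.log_mul (hp _) (hp _), Real.log_mul (by simp [hp]) (hp _),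
    Real.log_mul (by simp [hp]) (hp _), Real.log_mul (hp _) (hp _)]
  simp only [(key _ _).2, entropySum, Fin.sum_univ_succ, Fin.sum_univ_zero]
  simp [sgn]
  ring

/-! ### The Hessian on the surface has rank two -/

/-- Row and column sums together with the entries of the `2 × 2` table `rᵢ pⱼ`, `p = (x, 1 - x)`,
in the order of `coeffs`. -/
def productMargins (r₁ r₂ x : ℝ) : Fin 9 → ℝ :=
  ![r₁ + r₂, r₁ * x, r₁ * (1 - x), r₂ * x, r₂ * (1 - x), (r₁ + r₂) * x, (r₁ + r₂) * (1 - x), r₁, r₂]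

/-- The interaction contrast of the table `rᵢ pⱼ`, `p = (x, 1 - x)`. -/
def contrast (r₁ r₂ x : ℝ) : Fin 4 → ℝ :=
  ![r₂ * (1 - x), -(r₂ * x), -(r₁ * (1 - x)), r₁ * x]

/-- For a table of product form, the chi-square form of the entries minus those of the margins
plus that of the total only sees the interaction contrast, so that it has rank one. -/
lemma sum_coeffs_div_productMargins {r₁ r₂ x : ℝ} (h₁ : 0 < r₁) (h₂ : 0 < r₂) (hx : 0 < x)
    (hx' : x < 1) (i j : Fin 4) :
    ∑ t, sgn t * (coeffs t i * coeffs t j) * (1 / productMargins r₁ r₂ x t) =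
      contrast r₁ r₂ x i * contrast r₁ r₂ x j /
        ((r₁ + r₂) * r₁ * r₂ * (x * (1 - x))) := by
  have h3 : 0 < 1 - x := sub_pos.2 hx'
  have h4 : 0 < r₁ + r₂ := by positivity
  simp only [Fin.sum_univ_succ, Fin.sum_univ_zero]
  fin_cases i <;> fin_cases j <;> simp [sgn, coeffs, productMargins, contrast] <;> field_simp <;>
    ring

lemma mem_domain {p : ℝ × ℝ} : p ∈ domain ↔ (0 < p.1 ∧ p.1 < 3 / 10) ∧ 3 / 5 < p.2 ∧ p.2 < 1 :=
  Iff.rfl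

/-- At `k (u, v)` the nine linear forms have the values of a table of product form. -/
lemma linForm_coeffs_k {p : ℝ × ℝ} (hp : p ∈ domain) (t : Fin 9) :
    linForm (coeffs t) (k p) =
      productMargins ((p.2 - 3 / 10) / (p.2 - p.1)) ((p.2 - 3 / 5) / (p.2 - p.1)) p.1 t := by
  obtain ⟨⟨h1, h2⟩, h3, h4⟩ := mem_domain.1 hp
  have h5 : p.2 - p.1 ≠ 0 := by linarith
  rw [linForm_apply]
  fin_cases t <;> simp [coeffs, k, productMargins, Fin.sum_univ_succ] <;> field_simp <;> ring

/-- At `k (u, v)` the complements of the nine linear forms to the weights also have the values of a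
table of product form. -/
lemma wt_sub_linForm_coeffs_k {p : ℝ × ℝ} (hp : p ∈ domain) (t : Fin 9) :
    wt t - linForm (coeffs t) (k p) =
      productMargins ((3 / 10 - p.1) / (p.2 - p.1)) ((3 / 5 - p.1) / (p.2 - p.1)) p.2 t := by
  obtain ⟨⟨h1, h2⟩, h3, h4⟩ := mem_domain.1 hp
  have h5 : p.2 - p.1 ≠ 0 := by linarith
  rw [linForm_apply]
  fin_cases t <;> simp [coeffs, k, wt, productMargins, Fin.sum_univ_succ] <;> field_simp <;> ring

lemma productMargins_pos {r₁ r₂ x : ℝ} (h₁ : 0 < r₁) (h₂ : 0 < r₂) (hx : 0 < x)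
    (hx' : x < 1) (t : Fin 9) : 0 < productMargins r₁ r₂ x t := by
  have h3 : 0 < 1 - x := sub_pos.2 hx'
  fin_cases t <;> simp [productMargins] <;> positivity

lemma k_mem_entropyRegion {p : ℝ × ℝ} (hp : p ∈ domain) : k p ∈ entropyRegion wt coeffs := by
  obtain ⟨⟨h1, h2⟩, h3, h4⟩ := mem_domain.1 hp
  have h5 : 0 < p.2 - p.1 := by linarith
  refine fun t => ⟨?_, sub_pos.1 ?_⟩
  · rw [linForm_coeffs_k hp]
    exact productMargins_pos (div_pos (by linarith) h5) (div_pos (by linarith) h5) h1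
      (by linarith) t
  · rw [wt_sub_linForm_coeffs_k hp]
    exact productMargins_pos (div_pos (by linarith) h5) (div_pos (by linarith) h5) (by linarith)
      h4 t

lemma g_eventuallyEq {p : ℝ × ℝ} (hp : p ∈ domain) :
    g =ᶠ[𝓝 (k p)] entropySum sgn wt coeffs := by
  filter_upwards [(isOpen_entropyRegion wt coeffs).mem_nhds (k_mem_entropyRegion hp)] with y hy
  exact g_eq_entropySum hy

lemma contDiffAt_g {p : ℝ × ℝ} (hp : p ∈ domain) : ContDiffAt ℝ 2 g (k p) :=
  (contDiffAt_entropySum (k_mem_entropyRegion hp)).congr_of_eventuallyEq (g_eventuallyEq hp)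

/-- The contrast of the table of entries of `k (u, v)`, up to scaling. -/
noncomputable def vecA (p : ℝ × ℝ) : Fin 4 → ℝ := contrast (p.2 - 3 / 10) (p.2 - 3 / 5) p.1

/-- The contrast of the table of complements of the entries of `k (u, v)`, up to scaling. -/
noncomputable def vecB (p : ℝ × ℝ) : Fin 4 → ℝ := contrast (3 / 10 - p.1) (3 / 5 - p.1) p.2

/-- The coefficient of `vecA` in the Hessian, with its pole `1 / mA` removed. -/
noncomputable def coefA (p : ℝ × ℝ) : ℝ :=
  (p.2 - p.1) / ((2 * p.2 - 9 / 10) * (p.2 - 3 / 10) * (1 - p.1))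

/-- The coefficient of `vecB` in the Hessian, with its pole `1 / mB` removed. -/
noncomputable def coefB (p : ℝ × ℝ) : ℝ :=
  (p.2 - p.1) / ((9 / 10 - 2 * p.1) * (3 / 5 - p.1) * p.2)

/-- The factor vanishing on the edges `u = 0` and `v = 3/5`. -/
noncomputable def mA (p : ℝ × ℝ) : ℝ := p.1 * (p.2 - 3 / 5)

/-- The factor vanishing on the edges `u = 3/10` and `v = 1`. -/
noncomputable def mB (p : ℝ × ℝ) : ℝ := (3 / 10 - p.1) * (1 - p.2)

lemma contrast_div (r₁ r₂ x c : ℝ) (i : Fin 4) :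
    contrast (r₁ / c) (r₂ / c) x i = contrast r₁ r₂ x i / c := by
  fin_cases i <;> simp [contrast] <;> ring

/-- The negative of the Hessian is a positive combination of `A Aᵀ` and `B Bᵀ`. -/
lemma H_apply {p : ℝ × ℝ} (hp : p ∈ domain) (i j : Fin 4) :
    H p i j = -(coefA p / mA p * (vecA p i * vecA p j) +
      coefB p / mB p * (vecB p i * vecB p j)) := by
  obtain ⟨⟨h1, h2⟩, h3, h4⟩ := mem_domain.1 hp
  have h5 : 0 < p.2 - p.1 := by linarith
  have a1 : 0 < p.2 - 3 / 10 := by linarith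
  have a2 : 0 < p.2 - 3 / 5 := by linarith
  have a3 : 0 < 1 - p.1 := by linarith
  have a4 : 0 < 2 * p.2 - 9 / 10 := by linarith
  have b1 : 0 < 3 / 10 - p.1 := by linarith
  have b2 : 0 < 3 / 5 - p.1 := by linarith
  have b3 : 0 < 1 - p.2 := by linarith
  have b4 : 0 < 9 / 10 - 2 * p.1 := by linarith
  have b5 : 0 < p.2 := by linarith
  have eA := sum_coeffs_div_productMargins (div_pos a1 h5) (div_pos a2 h5) h1 (by linarith) i j
  have eB := sum_coeffs_div_productMargins (div_pos b1 h5) (div_pos b2 h5) b5 h4 i j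
  rw [contrast_div, contrast_div, ← add_div,
    show p.2 - 3 / 10 + (p.2 - 3 / 5) = 2 * p.2 - 9 / 10 by ring] at eA
  rw [contrast_div, contrast_div, ← add_div,
    show 3 / 10 - p.1 + (3 / 5 - p.1) = 9 / 10 - 2 * p.1 by ring] at eB
  have e : H p i j = -((∑ t, sgn t * (coeffs t i * coeffs t j) *
        (1 / productMargins ((p.2 - 3 / 10) / (p.2 - p.1)) ((p.2 - 3 / 5) / (p.2 - p.1)) p.1 t)) +
      ∑ t, sgn t * (coeffs t i * coeffs t j) *
        (1 / productMargins ((3 / 10 - p.1) / (p.2 - p.1)) ((3 / 5 - p.1) / (p.2 - p.1)) p.2 t)) := by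
    rw [H, hessian_congr (g_eventuallyEq hp), hessian_entropySum (k_mem_entropyRegion hp),
      ← Finset.sum_add_distrib, ← Finset.sum_neg_distrib]
    refine Finset.sum_congr rfl fun t _ => ?_
    rw [wt_sub_linForm_coeffs_k hp, linForm_coeffs_k hp]
    ring
  rw [e, eA, eB, ← vecA, ← vecB]
  congr 2
  · rw [coefA, mA]
    field_simp
  · rw [coefB, mB]
    field_simp

open Polynomial in
/-- The eigenvalues of `-(a v vᵀ + b w wᵀ)` on `ℝ⁴`: besides `0, 0` they are those of the Gram
matrix of `√a v` and `√b w`, up to sign. -/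
lemma roots_charpoly_of_rank_two {M : Matrix (Fin 4) (Fin 4) ℝ} {a b : ℝ} {v w : Fin 4 → ℝ}
    (hM : ∀ i j, M i j = -(a * (v i * v j) + b * (w i * w j))) {l₁ l₂ : ℝ}
    (hs : l₁ + l₂ = -(a * (v ⬝ᵥ v) + b * (w ⬝ᵥ w)))
    (hd : l₁ * l₂ = a * b * ((v ⬝ᵥ v) * (w ⬝ᵥ w) - (v ⬝ᵥ w) ^ 2)) :
    M.charpoly.roots = {0, 0, l₁, l₂} := by
  set P : Matrix (Fin 4) (Fin 2) ℝ := Matrix.of fun i j => ![-(a * v i), -(b * w i)] j with hP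
  set Q : Matrix (Fin 2) (Fin 4) ℝ := Matrix.of fun i j => ![v j, w j] i with hQ
  have hPQ : M = P * Q := by
    ext i j
    rw [hM, Matrix.mul_apply, Fin.sum_univ_two]
    simp [hP, hQ]
    ring
  have hchar : M.charpoly = (({0, 0, l₁, l₂} : Multiset ℝ).map fun r => X - C r).prod := by
    rw [hPQ, Matrix.charpoly_mul_comm_of_le _ _ (by simp), Matrix.charpoly_fin_two]
    have ht : (Q * P).trace = l₁ + l₂ := by
      rw [hs, Matrix.trace_fin_two, Matrix.mul_apply, Matrix.mul_apply]
      simp [hP, hQ, dotProduct, Fin.sum_univ_succ]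
      ring
    have hdet : (Q * P).det = l₁ * l₂ := by
      rw [hd, Matrix.det_fin_two]
      simp [Matrix.mul_apply, hP, hQ, dotProduct, Fin.sum_univ_succ]
      ring
    rw [ht, hdet]
    simp
    ring
  rw [hchar, Polynomial.roots_multiset_prod_X_sub_C]

/-! ### The two nonzero eigenvalues -/

lemma contrast_dotProduct_contrast (r₁ r₂ x s₁ s₂ y : ℝ) :
    contrast r₁ r₂ x ⬝ᵥ contrast s₁ s₂ y =
      (r₁ * s₁ + r₂ * s₂) * (x * y + (1 - x) * (1 - y)) := by
  simp [contrast, dotProduct, Fin.sum_univ_succ]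
  ring

/-- The Gram determinant of two contrasts is positive if neither the weights `r`, `s` nor the
probabilities `x`, `y` are proportional. -/
lemma contrast_gram_pos {r₁ r₂ x s₁ s₂ y : ℝ} (hr : r₁ * s₂ - r₂ * s₁ ≠ 0) (hx : x - y ≠ 0) :
    0 < (contrast r₁ r₂ x ⬝ᵥ contrast r₁ r₂ x) * (contrast s₁ s₂ y ⬝ᵥ contrast s₁ s₂ y) -
      (contrast r₁ r₂ x ⬝ᵥ contrast s₁ s₂ y) ^ 2 := by
  -- Lagrange's identity, used in both tensor factors
  have e : (contrast r₁ r₂ x ⬝ᵥ contrast r₁ r₂ x) * (contrast s₁ s₂ y ⬝ᵥ contrast s₁ s₂ y) -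
      (contrast r₁ r₂ x ⬝ᵥ contrast s₁ s₂ y) ^ 2 =
      (r₁ * s₁ + r₂ * s₂) ^ 2 * (x - y) ^ 2 +
        (r₁ * s₂ - r₂ * s₁) ^ 2 * (x * y + (1 - x) * (1 - y)) ^ 2 +
        (r₁ * s₂ - r₂ * s₁) ^ 2 * (x - y) ^ 2 := by
    simp only [contrast_dotProduct_contrast]
    ring
  rw [e]
  positivity

/-- The closed rectangle `[0, 3/10] × [3/5, 1]`. -/
def closedDomain : Set (ℝ × ℝ) := Icc (0 : ℝ) (3 / 10) ×ˢ Icc (3 / 5 : ℝ) 1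

lemma mem_closedDomain {p : ℝ × ℝ} :
    p ∈ closedDomain ↔ (0 ≤ p.1 ∧ p.1 ≤ 3 / 10) ∧ 3 / 5 ≤ p.2 ∧ p.2 ≤ 1 :=
  Iff.rfl

lemma isCompact_closedDomain : IsCompact closedDomain := isCompact_Icc.prod isCompact_Icc

lemma domain_subset_closedDomain : domain ⊆ closedDomain :=
  prod_mono Ioo_subset_Icc_self Ioo_subset_Icc_self

/-- The nonzero eigenvalue of `coefA • A Aᵀ`. -/
noncomputable def normA (p : ℝ × ℝ) : ℝ := coefA p * (vecA p ⬝ᵥ vecA p)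

/-- The nonzero eigenvalue of `coefB • B Bᵀ`. -/
noncomputable def normB (p : ℝ × ℝ) : ℝ := coefB p * (vecB p ⬝ᵥ vecB p)

/-- The product of the two nonzero eigenvalues of the Hessian, multiplied by `mA * mB`. -/
noncomputable def gramDet (p : ℝ × ℝ) : ℝ :=
  coefA p * coefB p * ((vecA p ⬝ᵥ vecA p) * (vecB p ⬝ᵥ vecB p) - (vecA p ⬝ᵥ vecB p) ^ 2)

/-- The negative of the sum of the two nonzero eigenvalues of the Hessian, multiplied by
`mA * mB`. -/
noncomputable def trc (p : ℝ × ℝ) : ℝ := mB p * normA p + mA p * normB p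

/-- The negative of the smallest eigenvalue of the Hessian, multiplied by `mA * mB`: the larger root
of `X ^ 2 - trc * X + mA * mB * gramDet`. -/
noncomputable def bigRoot (p : ℝ × ℝ) : ℝ :=
  (trc p + √(trc p ^ 2 - 4 * (mA p * mB p * gramDet p))) / 2

/-- The smallest eigenvalue of the Hessian. -/
noncomputable def eigSmall (p : ℝ × ℝ) : ℝ := -(bigRoot p / (mA p * mB p))

/-- The larger nonzero eigenvalue of the Hessian. It is written in terms of `bigRoot` so that it
extends continuously to the edges. -/
noncomputable def eigLarge (p : ℝ × ℝ) : ℝ := -(gramDet p / bigRoot p)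

section Positivity

variable {p : ℝ × ℝ}

lemma mA_pos (hp : p ∈ domain) : 0 < mA p := by
  obtain ⟨⟨h1, h2⟩, h3, h4⟩ := mem_domain.1 hp
  exact mul_pos h1 (by linarith)

lemma mB_pos (hp : p ∈ domain) : 0 < mB p := by
  obtain ⟨⟨h1, h2⟩, h3, h4⟩ := mem_domain.1 hp
  exact mul_pos (by linarith) (by linarith)

lemma mA_nonneg (hp : p ∈ closedDomain) : 0 ≤ mA p := by
  obtain ⟨⟨h1, h2⟩, h3, h4⟩ := mem_closedDomain.1 hp
  exact mul_nonneg h1 (by linarith)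

lemma mB_nonneg (hp : p ∈ closedDomain) : 0 ≤ mB p := by
  obtain ⟨⟨h1, h2⟩, h3, h4⟩ := mem_closedDomain.1 hp
  exact mul_nonneg (by linarith) (by linarith)

lemma coefA_pos (hp : p ∈ closedDomain) : 0 < coefA p := by
  obtain ⟨⟨h1, h2⟩, h3, h4⟩ := mem_closedDomain.1 hp
  exact div_pos (by linarith) (mul_pos (mul_pos (by linarith) (by linarith)) (by linarith))

lemma coefB_pos (hp : p ∈ closedDomain) : 0 < coefB p := by
  obtain ⟨⟨h1, h2⟩, h3, h4⟩ := mem_closedDomain.1 hp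
  exact div_pos (by linarith) (mul_pos (mul_pos (by linarith) (by linarith)) (by linarith))

lemma gram_pos (hp : p ∈ closedDomain) :
    0 < (vecA p ⬝ᵥ vecA p) * (vecB p ⬝ᵥ vecB p) - (vecA p ⬝ᵥ vecB p) ^ 2 := by
  obtain ⟨⟨h1, h2⟩, h3, h4⟩ := mem_closedDomain.1 hp
  exact contrast_gram_pos (by nlinarith) (by linarith)

lemma gramDet_pos (hp : p ∈ closedDomain) : 0 < gramDet p :=
  mul_pos (mul_pos (coefA_pos hp) (coefB_pos hp)) (gram_pos hp)

lemma normA_pos (hp : p ∈ closedDomain) : 0 < normA p := by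
  refine mul_pos (coefA_pos hp) ((dotProduct_self_star_nonneg (vecA p)).lt_of_ne' fun h0 => ?_)
  have := gram_pos hp
  simp only [star_trivial] at h0
  rw [h0] at this
  nlinarith [sq_nonneg (vecA p ⬝ᵥ vecB p)]

lemma normB_pos (hp : p ∈ closedDomain) : 0 < normB p := by
  refine mul_pos (coefB_pos hp) ((dotProduct_self_star_nonneg (vecB p)).lt_of_ne' fun h0 => ?_)
  have := gram_pos hp
  simp only [star_trivial] at h0
  rw [h0] at this
  nlinarith [sq_nonneg (vecA p ⬝ᵥ vecB p)]

lemma normA_mul_normB (p : ℝ × ℝ) :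
    normA p * normB p = gramDet p + coefA p * coefB p * (vecA p ⬝ᵥ vecB p) ^ 2 := by
  simp only [normA, normB, gramDet]
  ring

lemma gramDet_le (hp : p ∈ closedDomain) : gramDet p ≤ normA p * normB p := by
  have := coefA_pos hp
  have := coefB_pos hp
  rw [normA_mul_normB]
  exact le_add_of_nonneg_right (by positivity)

lemma trc_nonneg (hp : p ∈ closedDomain) : 0 ≤ trc p := by
  have := normA_pos hp
  have := normB_pos hp
  have := mA_nonneg hp
  have := mB_nonneg hp
  unfold trc
  positivity

lemma trc_pos (hp : p ∈ closedDomain) (h : 0 < mA p ∨ 0 < mB p) : 0 < trc p := by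
  have := normA_pos hp
  have := normB_pos hp
  have := mA_nonneg hp
  have := mB_nonneg hp
  unfold trc
  rcases h with h | h <;> positivity

lemma discr_nonneg (hp : p ∈ closedDomain) :
    0 ≤ trc p ^ 2 - 4 * (mA p * mB p * gramDet p) := by
  have h1 := mul_nonneg (mul_nonneg (mA_nonneg hp) (mB_nonneg hp)) (sub_nonneg.2 (gramDet_le hp))
  unfold trc
  nlinarith [sq_nonneg (mB p * normA p - mA p * normB p)]

lemma trc_le_two_mul_bigRoot (p : ℝ × ℝ) : trc p ≤ 2 * bigRoot p := by
  have := Real.sqrt_nonneg (trc p ^ 2 - 4 * (mA p * mB p * gramDet p))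
  unfold bigRoot
  linarith

lemma bigRoot_nonneg (hp : p ∈ closedDomain) : 0 ≤ bigRoot p := by
  linarith [trc_le_two_mul_bigRoot p, trc_nonneg hp]

lemma bigRoot_pos (hp : p ∈ closedDomain) (h : 0 < mA p ∨ 0 < mB p) : 0 < bigRoot p := by
  linarith [trc_le_two_mul_bigRoot p, trc_pos hp h]

lemma bigRoot_sq (hp : p ∈ closedDomain) :
    bigRoot p ^ 2 + mA p * mB p * gramDet p = trc p * bigRoot p := by
  have := Real.sq_sqrt (discr_nonneg hp)
  unfold bigRoot
  linear_combination this / 4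

lemma le_bigRoot_sq (hp : p ∈ closedDomain) : mA p * mB p * gramDet p ≤ bigRoot p ^ 2 := by
  nlinarith [discr_nonneg hp, trc_le_two_mul_bigRoot p, trc_nonneg hp]

lemma roots_charpoly_H (hp : p ∈ domain) :
    (H p).charpoly.roots = {0, 0, eigSmall p, eigLarge p} := by
  have hc := domain_subset_closedDomain hp
  have hA := mA_pos hp
  have hB := mB_pos hp
  have hM := bigRoot_pos hc (Or.inl hA)
  have hsq := bigRoot_sq hc
  refine roots_charpoly_of_rank_two (H_apply hp) ?_ ?_
  · have e : eigSmall p + eigLarge p = -(trc p / (mA p * mB p)) := by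
      rw [eigSmall, eigLarge]
      field_simp
      linear_combination -hsq
    rw [e, trc, normA, normB]
    field_simp
  · rw [eigSmall, eigLarge, gramDet]
    field_simp

lemma eigSmall_le_eigLarge (hp : p ∈ domain) : eigSmall p ≤ eigLarge p := by
  have hc := domain_subset_closedDomain hp
  have hA := mA_pos hp
  have hB := mB_pos hp
  have hM := bigRoot_pos hc (Or.inl hA)
  rw [eigSmall, eigLarge, neg_le_neg_iff, div_le_div_iff₀ hM (by positivity)]
  linarith [le_bigRoot_sq hc]

end Positivity

/-! ### Continuity up to the boundary -/

lemma continuous_mA : Continuous mA := by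
  unfold mA
  fun_prop

lemma continuous_mB : Continuous mB := by
  unfold mB
  fun_prop

section Continuity

variable {p : ℝ × ℝ}

lemma continuousAt_coefA (hp : p ∈ closedDomain) : ContinuousAt coefA p := by
  obtain ⟨⟨h1, h2⟩, h3, h4⟩ := mem_closedDomain.1 hp
  have : (2 * p.2 - 9 / 10) * (p.2 - 3 / 10) * (1 - p.1) ≠ 0 :=
    (mul_pos (mul_pos (by linarith) (by linarith)) (by linarith)).ne'
  unfold coefA
  fun_prop (disch := assumption)

lemma continuousAt_coefB (hp : p ∈ closedDomain) : ContinuousAt coefB p := by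
  obtain ⟨⟨h1, h2⟩, h3, h4⟩ := mem_closedDomain.1 hp
  have : (9 / 10 - 2 * p.1) * (3 / 5 - p.1) * p.2 ≠ 0 :=
    (mul_pos (mul_pos (by linarith) (by linarith)) (by linarith)).ne'
  unfold coefB
  fun_prop (disch := assumption)

lemma continuousAt_normA (hp : p ∈ closedDomain) : ContinuousAt normA p := by
  have := continuousAt_coefA hp
  unfold normA
  simp only [vecA, contrast_dotProduct_contrast]
  fun_prop

lemma continuousAt_normB (hp : p ∈ closedDomain) : ContinuousAt normB p := by
  have := continuousAt_coefB hp
  unfold normB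
  simp only [vecB, contrast_dotProduct_contrast]
  fun_prop

lemma continuousAt_gramDet (hp : p ∈ closedDomain) : ContinuousAt gramDet p := by
  have := continuousAt_coefA hp
  have := continuousAt_coefB hp
  unfold gramDet
  simp only [vecA, vecB, contrast_dotProduct_contrast]
  fun_prop

lemma continuousAt_bigRoot (hp : p ∈ closedDomain) : ContinuousAt bigRoot p := by
  have := continuousAt_normA hp
  have := continuousAt_normB hp
  have := continuousAt_gramDet hp
  have := continuous_mA
  have := continuous_mB
  unfold bigRoot trc
  fun_prop

lemma continuousAt_eigLarge (hp : p ∈ closedDomain) (h : 0 < mA p ∨ 0 < mB p) :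
    ContinuousAt eigLarge p :=
  ((continuousAt_gramDet hp).div (continuousAt_bigRoot hp) (bigRoot_pos hp h).ne').neg

lemma eigLarge_neg (hp : p ∈ closedDomain) (h : 0 < mA p ∨ 0 < mB p) : eigLarge p < 0 :=
  neg_neg_of_pos (div_pos (gramDet_pos hp) (bigRoot_pos hp h))

lemma continuousAt_eigSmall (hp : p ∈ domain) : ContinuousAt eigSmall p :=
  ((continuousAt_bigRoot (domain_subset_closedDomain hp)).div
    (continuous_mA.mul continuous_mB).continuousAt
    (mul_pos (mA_pos hp) (mB_pos hp)).ne').neg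

end Continuity

/-- On the compact closed rectangle `gramDet` is bounded below by a positive constant and `bigRoot`
is bounded above. -/
lemma exists_eigLarge_le : ∃ c > 0, ∀ p ∈ domain, eigLarge p ≤ -c := by
  obtain ⟨z, hz, hzmin⟩ := isCompact_closedDomain.exists_isMinOn
    ⟨(0, 1), mem_closedDomain.2 (by norm_num)⟩
    fun p hp => (continuousAt_gramDet hp).continuousWithinAt
  obtain ⟨K, hK⟩ := isCompact_closedDomain.bddAbove_image
    fun p hp => (continuousAt_bigRoot hp).continuousWithinAt
  have hKp : ∀ p ∈ closedDomain, bigRoot p ≤ K := fun p hp => hK ⟨p, hp, rfl⟩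
  have hz0 := gramDet_pos hz
  have hK0 : 0 ≤ K := (bigRoot_nonneg hz).trans (hKp z hz)
  refine ⟨gramDet z / (K + 1), by positivity, fun p hp => neg_le_neg ?_⟩
  have hc := domain_subset_closedDomain hp
  exact div_le_div₀ (gramDet_pos hc).le (hzmin hc) (bigRoot_pos hc (Or.inl (mA_pos hp)))
    ((hKp p hc).trans (by linarith))

/-! ### Edges -/

/-- A function that agrees on the domain with one that is continuous and negative at the points
of an edge has an edge limit there. -/
lemma hasEdgeLimit_of_continuousAt {F F' : ℝ × ℝ → ℝ} {I : Set ℝ} {e : ℝ → ℝ × ℝ}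
    (he : Continuous e) (hF : ∀ p ∈ domain, F p = F' p)
    (hF' : ∀ t ∈ I, ContinuousAt F' (e t) ∧ F' (e t) < 0) : HasEdgeLimit F I e := by
  refine ⟨F' ∘ e, fun t ht => ((hF' t ht).1.comp he.continuousAt).continuousWithinAt,
    fun t ht => ⟨(hF' t ht).2, ?_⟩⟩
  refine ((hF' t ht).1.tendsto.mono_left nhdsWithin_le_nhds).congr' ?_
  filter_upwards [self_mem_nhdsWithin] with p hp using (hF p hp).symm

lemma hasEdgeLimit_eigLarge {I : Set ℝ} {e : ℝ → ℝ × ℝ} (he : Continuous e)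
    (hI : ∀ t ∈ I, e t ∈ closedDomain ∧ (0 < mA (e t) ∨ 0 < mB (e t))) :
    HasEdgeLimit eigLarge I e :=
  hasEdgeLimit_of_continuousAt he (fun _ _ => rfl) fun t ht =>
    ⟨continuousAt_eigLarge (hI t ht).1 (hI t ht).2, eigLarge_neg (hI t ht).1 (hI t ht).2⟩

/-- If the factor `d` removes the pole of `1 / (mA * mB)` along an edge, leaving `1 / r` with
`r > 0`, then `d * eigSmall` has a limit along that edge. -/
lemma hasEdgeLimit_mul_eigSmall {d r : ℝ × ℝ → ℝ} {I : Set ℝ} {e : ℝ → ℝ × ℝ} (he : Continuous e)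
    (hr : Continuous r) (hd : ∀ p, mA p * mB p = d p * r p)
    (hI : ∀ t ∈ I, e t ∈ closedDomain ∧ (0 < mA (e t) ∨ 0 < mB (e t)) ∧ 0 < r (e t)) :
    HasEdgeLimit (fun p => d p * eigSmall p) I e := by
  refine hasEdgeLimit_of_continuousAt (F' := fun p => -(bigRoot p / r p)) he (fun p hp => ?_)
    fun t ht => ?_
  · have h0 : d p * r p ≠ 0 := hd p ▸ (mul_pos (mA_pos hp) (mB_pos hp)).ne'
    have h1 := left_ne_zero_of_mul h0
    have h2 := right_ne_zero_of_mul h0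
    rw [eigSmall, hd]
    field_simp
  · obtain ⟨hc, hm, h0⟩ := hI t ht
    exact ⟨((continuousAt_bigRoot hc).div hr.continuousAt h0.ne').neg,
      neg_neg_of_pos (div_pos (bigRoot_pos hc hm) h0)⟩

lemma edge_left {t : ℝ} (ht : t ∈ Ioo (3 / 5 : ℝ) 1) :
    ((0 : ℝ), t) ∈ closedDomain ∧ 0 < mB (0, t) := by
  obtain ⟨h1, h2⟩ := ht
  exact ⟨mem_closedDomain.2 ⟨by norm_num, h1.le, h2.le⟩, mul_pos (by norm_num) (sub_pos.2 h2)⟩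

lemma edge_right {t : ℝ} (ht : t ∈ Ioo (3 / 5 : ℝ) 1) :
    ((3 / 10 : ℝ), t) ∈ closedDomain ∧ 0 < mA (3 / 10, t) := by
  obtain ⟨h1, h2⟩ := ht
  exact ⟨mem_closedDomain.2 ⟨by norm_num, h1.le, h2.le⟩, mul_pos (by norm_num) (sub_pos.2 h1)⟩

lemma edge_bottom {t : ℝ} (ht : t ∈ Ioo (0 : ℝ) (3 / 10)) :
    (t, (3 / 5 : ℝ)) ∈ closedDomain ∧ 0 < mB (t, 3 / 5) := by
  obtain ⟨h1, h2⟩ := ht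
  exact ⟨mem_closedDomain.2 ⟨⟨h1.le, h2.le⟩, by norm_num⟩, mul_pos (sub_pos.2 h2) (by norm_num)⟩

lemma edge_top {t : ℝ} (ht : t ∈ Ioo (0 : ℝ) (3 / 10)) :
    (t, (1 : ℝ)) ∈ closedDomain ∧ 0 < mA (t, 1) := by
  obtain ⟨h1, h2⟩ := ht
  exact ⟨mem_closedDomain.2 ⟨⟨h1.le, h2.le⟩, by norm_num⟩, mul_pos h1 (by norm_num)⟩

lemma edge_left_eigSmall :
    HasEdgeLimit (fun p => p.1 * eigSmall p) (Ioo (3 / 5) 1) (fun v => (0, v)) := by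
  refine hasEdgeLimit_mul_eigSmall (r := fun p => (p.2 - 3 / 5) * mB p) (by fun_prop)
    (by have := continuous_mB; fun_prop) (fun p => by rw [mA]; ring) fun t ht => ?_
  obtain ⟨hc, hm⟩ := edge_left ht
  exact ⟨hc, Or.inr hm, mul_pos (sub_pos.2 ht.1) hm⟩

lemma edge_right_eigSmall :
    HasEdgeLimit (fun p => (3 / 10 - p.1) * eigSmall p) (Ioo (3 / 5) 1)
      (fun v => (3 / 10, v)) := by
  refine hasEdgeLimit_mul_eigSmall (d := fun p => 3 / 10 - p.1) (r := fun p => (1 - p.2) * mA p)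
    (by fun_prop) (by have := continuous_mA; fun_prop) (fun p => by rw [mB]; ring) fun t ht => ?_
  obtain ⟨hc, hm⟩ := edge_right ht
  exact ⟨hc, Or.inl hm, mul_pos (sub_pos.2 ht.2) hm⟩

lemma edge_bottom_eigSmall :
    HasEdgeLimit (fun p => (p.2 - 3 / 5) * eigSmall p) (Ioo 0 (3 / 10))
      (fun u => (u, 3 / 5)) := by
  refine hasEdgeLimit_mul_eigSmall (d := fun p => p.2 - 3 / 5) (r := fun p => p.1 * mB p)
    (by fun_prop) (by have := continuous_mB; fun_prop) (fun p => by rw [mA]; ring) fun t ht => ?_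
  obtain ⟨hc, hm⟩ := edge_bottom ht
  exact ⟨hc, Or.inr hm, mul_pos ht.1 hm⟩

lemma edge_top_eigSmall :
    HasEdgeLimit (fun p => (1 - p.2) * eigSmall p) (Ioo 0 (3 / 10)) (fun u => (u, 1)) := by
  refine hasEdgeLimit_mul_eigSmall (d := fun p => 1 - p.2) (r := fun p => (3 / 10 - p.1) * mA p)
    (by fun_prop) (by have := continuous_mA; fun_prop) (fun p => by rw [mB]; ring) fun t ht => ?_
  obtain ⟨hc, hm⟩ := edge_top ht
  exact ⟨hc, Or.inl hm, mul_pos (sub_pos.2 ht.2) hm⟩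

/-! ### Corners -/

lemma toCorner_le_nhds : toCorner ≤ 𝓝 ((0 : ℝ), (0 : ℝ)) := by
  rw [nhds_prod_eq]
  exact Filter.prod_mono nhdsWithin_le_nhds nhdsWithin_le_nhds

lemma eventually_toCorner :
    ∀ᶠ q in toCorner, (0 < q.1 ∧ q.1 < 3 / 10) ∧ 0 < q.2 ∧ q.2 < 2 / 5 :=
  Filter.prod_mem_prod (Ioo_mem_nhdsGT (by norm_num : (0 : ℝ) < 3 / 10))
    (Ioo_mem_nhdsGT (by norm_num : (0 : ℝ) < 2 / 5))

/-- A product corner is one where only one of `mA` and `mB` vanishes: it equals `μ * ν` near the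
corner, and the other one is `r`. -/
lemma hasProductCorner {φ : ℝ × ℝ → ℝ × ℝ} {r : ℝ × ℝ → ℝ} (hφ : Continuous φ) (hr : Continuous r)
    (hdom : ∀ᶠ q in toCorner, φ q ∈ domain)
    (hm : ∀ q, mA (φ q) * mB (φ q) = q.1 * q.2 * r (φ q)) (hc : φ (0, 0) ∈ closedDomain)
    (hpos : 0 < mA (φ (0, 0)) ∨ 0 < mB (φ (0, 0))) (hr0 : 0 < r (φ (0, 0))) :
    HasProductCorner (fun q => eigSmall (φ q)) (fun q => eigLarge (φ q)) := by
  have hlim : Tendsto φ toCorner (𝓝 (φ (0, 0))) := hφ.continuousAt.mono_left toCorner_le_nhds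
  refine ⟨⟨-(bigRoot (φ (0, 0)) / r (φ (0, 0))),
    neg_neg_of_pos (div_pos (bigRoot_pos hc hpos) hr0), ?_⟩,
    eigLarge (φ (0, 0)), eigLarge_neg hc hpos, (continuousAt_eigLarge hc hpos).tendsto.comp hlim⟩
  refine ((((continuousAt_bigRoot hc).div hr.continuousAt hr0.ne').neg).tendsto.comp
    hlim).congr' ?_
  filter_upwards [hdom] with q hq
  have h0 : q.1 * q.2 * r (φ q) ≠ 0 := hm q ▸ (mul_pos (mA_pos hq) (mB_pos hq)).ne'
  have h1 := left_ne_zero_of_mul h0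
  have h2 := right_ne_zero_of_mul h0
  simp only [Function.comp, Pi.neg_apply, Pi.div_apply, eigSmall, hm]
  rw [mul_neg, mul_div_assoc', mul_div_mul_left _ _ h1]

/-- The larger root of `X ^ 2 - (x + y) X + x y (1 - ε)` is close to `max x y`. -/
lemma bigRoot_bounds {x y ε : ℝ} (hx : 0 ≤ x) (hy : 0 ≤ y) (hε : 0 ≤ ε) :
    max x y ≤ (x + y + √((x - y) ^ 2 + 4 * (x * y * ε))) / 2 ∧
      (x + y + √((x - y) ^ 2 + 4 * (x * y * ε))) / 2 ≤ (1 + √ε) * max x y := by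
  have hm : x + y + |x - y| = 2 * max x y := by
    rcases le_total x y with h | h
    · rw [abs_of_nonpos (by linarith), max_eq_right h]; ring
    · rw [abs_of_nonneg (by linarith), max_eq_left h]; ring
  have h0 : 0 ≤ x * y * ε := by positivity
  have hK : 0 ≤ max x y := hx.trans (le_max_left _ _)
  have hlow : |x - y| ≤ √((x - y) ^ 2 + 4 * (x * y * ε)) := Real.abs_le_sqrt (by linarith)
  have hup : √((x - y) ^ 2 + 4 * (x * y * ε)) ≤ |x - y| + 2 * (√ε * max x y) := by
    refine Real.sqrt_le_iff.2 ⟨by positivity, ?_⟩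
    have h1 : x * y ≤ max x y * max x y :=
      mul_le_mul (le_max_left _ _) (le_max_right _ _) hy hK
    have h2 := mul_le_mul_of_nonneg_right h1 hε
    have h3 : 0 ≤ |x - y| * (√ε * max x y) := by positivity
    have h4 : (√ε * max x y) ^ 2 = max x y * max x y * ε := by
      rw [mul_pow, Real.sq_sqrt hε]; ring
    nlinarith [sq_abs (x - y)]
  constructor <;> linarith

lemma tendsto_max_div_max_and_min_div_min {α : Type*} {l : Filter α} {f₁ f₂ g₁ g₂ : α → ℝ}
    (h₁ : ∀ᶠ a in l, 0 < g₁ a) (h₂ : ∀ᶠ a in l, 0 < g₂ a)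
    (hf₁ : Tendsto (fun a => f₁ a / g₁ a) l (𝓝 1)) (hf₂ : Tendsto (fun a => f₂ a / g₂ a) l (𝓝 1)) :
    Tendsto (fun a => max (f₁ a) (f₂ a) / max (g₁ a) (g₂ a)) l (𝓝 1) ∧
      Tendsto (fun a => min (f₁ a) (f₂ a) / min (g₁ a) (g₂ a)) l (𝓝 1) := by
  have hmin := hf₁.min hf₂
  have hmax := hf₁.max hf₂
  rw [min_self] at hmin
  rw [max_self] at hmax
  have hpos : ∀ᶠ a in l, 0 < min (f₁ a / g₁ a) (f₂ a / g₂ a) :=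
    hmin.eventually_const_lt one_pos
  -- both quotients lie between the smaller and the larger of the two given ones
  have key : ∀ᶠ a in l,
      (min (f₁ a / g₁ a) (f₂ a / g₂ a) ≤ max (f₁ a) (f₂ a) / max (g₁ a) (g₂ a) ∧
        max (f₁ a) (f₂ a) / max (g₁ a) (g₂ a) ≤ max (f₁ a / g₁ a) (f₂ a / g₂ a)) ∧
      (min (f₁ a / g₁ a) (f₂ a / g₂ a) ≤ min (f₁ a) (f₂ a) / min (g₁ a) (g₂ a) ∧
        min (f₁ a) (f₂ a) / min (g₁ a) (g₂ a) ≤ max (f₁ a / g₁ a) (f₂ a / g₂ a)) := by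
    filter_upwards [h₁, h₂, hpos] with a h1 h2 h3
    have hM : 0 < max (g₁ a) (g₂ a) := lt_max_of_lt_left h1
    have hm : 0 < min (g₁ a) (g₂ a) := lt_min h1 h2
    have e1 : f₁ a = f₁ a / g₁ a * g₁ a := by field_simp
    have e2 : f₂ a = f₂ a / g₂ a * g₂ a := by field_simp
    set r := f₁ a / g₁ a
    set s := f₂ a / g₂ a
    have hrs : 0 < max r s := h3.trans_le min_le_max
    have l1 : min r s * g₁ a ≤ f₁ a := e1 ▸ mul_le_mul_of_nonneg_right (min_le_left _ _) h1.le
    have l2 : min r s * g₂ a ≤ f₂ a := e2 ▸ mul_le_mul_of_nonneg_right (min_le_right _ _) h2.le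
    have u1 : f₁ a ≤ max r s * g₁ a :=
      e1.le.trans (mul_le_mul_of_nonneg_right (le_max_left _ _) h1.le)
    have u2 : f₂ a ≤ max r s * g₂ a :=
      e2.le.trans (mul_le_mul_of_nonneg_right (le_max_right _ _) h2.le)
    rw [le_div_iff₀ hM, div_le_iff₀ hM, le_div_iff₀ hm, div_le_iff₀ hm,
      mul_max_of_nonneg _ _ h3.le, mul_max_of_nonneg _ _ hrs.le, mul_min_of_nonneg _ _ h3.le,
      mul_min_of_nonneg _ _ hrs.le]
    exact ⟨⟨max_le_max l1 l2, max_le_max u1 u2⟩, min_le_min l1 l2, min_le_min u1 u2⟩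
  exact ⟨tendsto_of_tendsto_of_tendsto_of_le_of_le' hmin hmax (key.mono fun _ h => h.1.1)
      (key.mono fun _ h => h.1.2),
    tendsto_of_tendsto_of_tendsto_of_le_of_le' hmin hmax (key.mono fun _ h => h.2.1)
      (key.mono fun _ h => h.2.2)⟩

/-- Where `vecA` and `vecB` become orthogonal, the nonzero eigenvalues are asymptotically those of
the two rank one parts of the Hessian, `-normA / mA` and `-normB / mB`. -/
lemma tendsto_eig_div {α : Type*} {l : Filter α} {φ : α → ℝ × ℝ} {p₀ : ℝ × ℝ}
    (hφ : Tendsto φ l (𝓝 p₀)) (hdom : ∀ᶠ q in l, φ q ∈ domain) (hc : p₀ ∈ closedDomain)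
    (horth : vecA p₀ ⬝ᵥ vecB p₀ = 0) :
    Tendsto (fun q => eigSmall (φ q) /
        -max (normA (φ q) / mA (φ q)) (normB (φ q) / mB (φ q))) l (𝓝 1) ∧
      Tendsto (fun q => eigLarge (φ q) /
        -min (normA (φ q) / mA (φ q)) (normB (φ q) / mB (φ q))) l (𝓝 1) := by
  have hX := normA_pos hc
  have hY := normB_pos hc
  have hρ : Tendsto (fun q => gramDet (φ q) / (normA (φ q) * normB (φ q))) l (𝓝 1) := by
    have h1 := ((continuousAt_gramDet hc).div ((continuousAt_normA hc).mul (continuousAt_normB hc))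
      (mul_pos hX hY).ne').tendsto.comp hφ
    have e : gramDet p₀ / (normA p₀ * normB p₀) = 1 := by
      have h2 := normA_mul_normB p₀
      rw [horth] at h2
      rw [h2]
      simpa using div_self (gramDet_pos hc).ne'
    simpa [Function.comp_def, e] using h1
  have hR : Tendsto (fun q => bigRoot (φ q) /
      max (mB (φ q) * normA (φ q)) (mA (φ q) * normB (φ q))) l (𝓝 1) := by
    have hup : Tendsto (fun q => 1 + √(1 - gramDet (φ q) / (normA (φ q) * normB (φ q)))) l
        (𝓝 1) := by
      simpa using ((hρ.const_sub 1).sqrt).const_add 1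
    have key : ∀ᶠ q in l, 1 ≤ bigRoot (φ q) /
        max (mB (φ q) * normA (φ q)) (mA (φ q) * normB (φ q)) ∧
        bigRoot (φ q) / max (mB (φ q) * normA (φ q)) (mA (φ q) * normB (φ q)) ≤
          1 + √(1 - gramDet (φ q) / (normA (φ q) * normB (φ q))) := by
      filter_upwards [hdom] with q hq
      have hcq := domain_subset_closedDomain hq
      have hA := mA_pos hq
      have hB := mB_pos hq
      have hXq := normA_pos hcq
      have hYq := normB_pos hcq
      have hε : 0 ≤ 1 - gramDet (φ q) / (normA (φ q) * normB (φ q)) :=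
        sub_nonneg.2 ((div_le_one (by positivity)).2 (gramDet_le hcq))
      have hb := bigRoot_bounds (mul_pos hB hXq).le (mul_pos hA hYq).le hε
      have e : bigRoot (φ q) = (mB (φ q) * normA (φ q) + mA (φ q) * normB (φ q) +
          √((mB (φ q) * normA (φ q) - mA (φ q) * normB (φ q)) ^ 2 +
            4 * (mB (φ q) * normA (φ q) * (mA (φ q) * normB (φ q)) *
              (1 - gramDet (φ q) / (normA (φ q) * normB (φ q)))))) / 2 := by
        rw [bigRoot, trc]
        congr 3
        field_simp
        ring
      rw [← e] at hb
      have hmax : 0 < max (mB (φ q) * normA (φ q)) (mA (φ q) * normB (φ q)) :=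
        lt_max_of_lt_left (mul_pos hB hXq)
      rw [le_div_iff₀ hmax, div_le_iff₀ hmax, one_mul]
      exact hb
    exact tendsto_of_tendsto_of_tendsto_of_le_of_le' tendsto_const_nhds hup
      (key.mono fun _ h => h.1) (key.mono fun _ h => h.2)
  have hQ := hρ.div hR one_ne_zero
  rw [div_one] at hQ
  constructor
  · refine hR.congr' ?_
    filter_upwards [hdom] with q hq
    have hA := mA_pos hq
    have hB := mB_pos hq
    have e : max (normA (φ q) / mA (φ q)) (normB (φ q) / mB (φ q)) =
        max (mB (φ q) * normA (φ q)) (mA (φ q) * normB (φ q)) / (mA (φ q) * mB (φ q)) := by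
      rw [← max_div_div_right (mul_pos hA hB).le]
      congr 1 <;> field_simp
    rw [e, eigSmall, neg_div_neg_eq, div_div_div_cancel_right₀ (by positivity)]
  · refine hQ.congr' ?_
    filter_upwards [hdom] with q hq
    have hcq := domain_subset_closedDomain hq
    have hA := mA_pos hq
    have hB := mB_pos hq
    have hXq := normA_pos hcq
    have hYq := normB_pos hcq
    have hM := bigRoot_pos hcq (Or.inl hA)
    have hmax : 0 < max (mB (φ q) * normA (φ q)) (mA (φ q) * normB (φ q)) :=
      lt_max_of_lt_left (mul_pos hB hXq)
    have hmin : 0 < min (mB (φ q) * normA (φ q)) (mA (φ q) * normB (φ q)) :=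
      lt_min (mul_pos hB hXq) (mul_pos hA hYq)
    have e : min (normA (φ q) / mA (φ q)) (normB (φ q) / mB (φ q)) =
        min (mB (φ q) * normA (φ q)) (mA (φ q) * normB (φ q)) / (mA (φ q) * mB (φ q)) := by
      rw [← min_div_div_right (mul_pos hA hB).le]
      congr 1 <;> field_simp
    have e2 := min_mul_max (mB (φ q) * normA (φ q)) (mA (φ q) * normB (φ q))
    rw [e, eigLarge, neg_div_neg_eq, Pi.div_apply]
    generalize max (mB (φ q) * normA (φ q)) (mA (φ q) * normB (φ q)) = K at *
    generalize min (mB (φ q) * normA (φ q)) (mA (φ q) * normB (φ q)) = k at *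
    field_simp
    linear_combination gramDet (φ q) * e2

/-- At a corner where `vecA` and `vecB` become orthogonal, it suffices to compare `normA / mA` and
`normB / mB` with `c₁ / μ` and `c₂ / ν`, in either order. -/
lemma hasMinMaxCorner {φ : ℝ × ℝ → ℝ × ℝ} {p₀ : ℝ × ℝ} (hlim : Tendsto φ toCorner (𝓝 p₀))
    (hdom : ∀ᶠ q in toCorner, φ q ∈ domain) (hc : p₀ ∈ closedDomain)
    (horth : vecA p₀ ⬝ᵥ vecB p₀ = 0) {c₁ c₂ : ℝ} (hc₁ : 0 < c₁) (hc₂ : 0 < c₂)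
    {s₁ s₂ : ℝ × ℝ → ℝ}
    (hs₁ : Tendsto (fun q => normA (φ q) / mA (φ q) / s₁ q) toCorner (𝓝 1))
    (hs₂ : Tendsto (fun q => normB (φ q) / mB (φ q) / s₂ q) toCorner (𝓝 1))
    (hs : s₁ = (fun q => c₁ / q.1) ∧ s₂ = (fun q => c₂ / q.2) ∨
      s₁ = (fun q => c₂ / q.2) ∧ s₂ = fun q => c₁ / q.1) :
    HasMinMaxCorner (fun q => eigSmall (φ q)) (fun q => eigLarge (φ q)) := by
  have hpos : ∀ᶠ q in toCorner, 0 < s₁ q ∧ 0 < s₂ q := by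
    filter_upwards [eventually_toCorner] with q hq
    have h1 := div_pos hc₁ hq.1.1
    have h2 := div_pos hc₂ hq.2.1
    rcases hs with ⟨rfl, rfl⟩ | ⟨rfl, rfl⟩
    exacts [⟨h1, h2⟩, ⟨h2, h1⟩]
  have hmax : ∀ q, min (-c₁ / q.1) (-c₂ / q.2) = -max (s₁ q) (s₂ q) := by
    intro q
    rcases hs with ⟨rfl, rfl⟩ | ⟨rfl, rfl⟩
    · rw [neg_div, neg_div, min_neg_neg]
    · rw [neg_div, neg_div, min_neg_neg, max_comm]
  have hmin : ∀ q, max (-c₁ / q.1) (-c₂ / q.2) = -min (s₁ q) (s₂ q) := by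
    intro q
    rcases hs with ⟨rfl, rfl⟩ | ⟨rfl, rfl⟩
    · rw [neg_div, neg_div, max_neg_neg]
    · rw [neg_div, neg_div, max_neg_neg, min_comm]
  obtain ⟨hS, hL⟩ := tendsto_eig_div hlim hdom hc horth
  obtain ⟨hM, hm⟩ := tendsto_max_div_max_and_min_div_min (hpos.mono fun _ h => h.1)
    (hpos.mono fun _ h => h.2) hs₁ hs₂
  have hq : ∀ᶠ q in toCorner, 0 < normA (φ q) / mA (φ q) ∧ 0 < normB (φ q) / mB (φ q) := by
    filter_upwards [hdom] with q hq
    have hcq := domain_subset_closedDomain hq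
    exact ⟨div_pos (normA_pos hcq) (mA_pos hq), div_pos (normB_pos hcq) (mB_pos hq)⟩
  refine ⟨-c₁, neg_neg_of_pos hc₁, -c₂, neg_neg_of_pos hc₂, ?_, ?_⟩
  · refine (one_mul (1 : ℝ) ▸ hS.mul hM).congr' ?_
    filter_upwards [hq] with q hq
    have : max (normA (φ q) / mA (φ q)) (normB (φ q) / mB (φ q)) ≠ 0 :=
      (lt_max_of_lt_left hq.1).ne'
    rw [hmax, div_neg, div_neg, neg_mul, div_mul_div_cancel₀ this]
  · refine (one_mul (1 : ℝ) ▸ hL.mul hm).congr' ?_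
    filter_upwards [hq] with q hq
    have : min (normA (φ q) / mA (φ q)) (normB (φ q) / mB (φ q)) ≠ 0 := (lt_min hq.1 hq.2).ne'
    rw [hmin, div_neg, div_neg, neg_mul, div_mul_div_cancel₀ this]

/-- If `m = s * a`, with `N` and `a` tending to nonzero limits, then `N / m` is asymptotic to
`N₀ / a₀ / s`. -/
lemma tendsto_div_div {α : Type*} {l : Filter α} {N m a s : α → ℝ} {N₀ a₀ : ℝ}
    (hs : ∀ᶠ q in l, s q ≠ 0) (hm : ∀ q, m q = s q * a q) (hN : Tendsto N l (𝓝 N₀))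
    (ha : Tendsto a l (𝓝 a₀)) (hN0 : N₀ ≠ 0) (ha0 : a₀ ≠ 0) :
    Tendsto (fun q => N q / m q / (N₀ / a₀ / s q)) l (𝓝 1) := by
  have h1 := (hN.div ha ha0).div_const (N₀ / a₀)
  rw [div_self (div_ne_zero hN0 ha0)] at h1
  refine h1.congr' ?_
  filter_upwards [hs] with q hq
  rw [hm, mul_comm, ← div_div, div_div_div_cancel_right₀ hq, Pi.div_apply]

lemma tendsto_toCorner {X : Type*} [TopologicalSpace X] {f : ℝ × ℝ → X} (hf : Continuous f)
    {y : X} (h : f (0, 0) = y) : Tendsto f toCorner (𝓝 y) :=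
  (hf.tendsto' _ _ h).mono_left toCorner_le_nhds

lemma corner_left_bottom : HasProductCorner (fun q => eigSmall (q.1, 3 / 5 + q.2))
    (fun q => eigLarge (q.1, 3 / 5 + q.2)) := by
  refine hasProductCorner (φ := fun q => (q.1, 3 / 5 + q.2)) (r := mB) (by fun_prop) continuous_mB
    ?_ (fun q => by simp [mA]) (mem_closedDomain.2 (by norm_num)) (Or.inr (by norm_num [mB]))
    (by norm_num [mB])
  filter_upwards [eventually_toCorner] with q hq
  exact mem_domain.2 ⟨hq.1, by simpa using hq.2.1, by linarith [hq.2.2]⟩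

lemma corner_right_top : HasProductCorner (fun q => eigSmall (3 / 10 - q.1, 1 - q.2))
    (fun q => eigLarge (3 / 10 - q.1, 1 - q.2)) := by
  refine hasProductCorner (φ := fun q => (3 / 10 - q.1, 1 - q.2)) (r := mA) (by fun_prop)
    continuous_mA ?_ (fun q => by simp [mB]; ring) (mem_closedDomain.2 (by norm_num))
    (Or.inl (by norm_num [mA])) (by norm_num [mA])
  filter_upwards [eventually_toCorner] with q hq
  exact mem_domain.2 ⟨⟨by linarith [hq.1.2], by simpa using hq.1.1⟩, by linarith [hq.2.2],
    by simpa using hq.2.1⟩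

lemma corner_left_top : HasMinMaxCorner (fun q => eigSmall (q.1, 1 - q.2))
    (fun q => eigLarge (q.1, 1 - q.2)) := by
  have hlim : Tendsto (fun q : ℝ × ℝ => (q.1, 1 - q.2)) toCorner (𝓝 (0, 1)) :=
    tendsto_toCorner (by fun_prop) (by norm_num)
  have hc : ((0 : ℝ), (1 : ℝ)) ∈ closedDomain := mem_closedDomain.2 (by norm_num)
  have hX := normA_pos hc
  have hY := normB_pos hc
  have hX' := tendsto_div_div (m := fun q => mA (q.1, 1 - q.2)) (a := fun q => 2 / 5 - q.2)
    (a₀ := 2 / 5) (s := fun q => q.1) (eventually_toCorner.mono fun q hq => hq.1.1.ne')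
    (fun q => by simp only [mA]; ring) ((continuousAt_normA hc).tendsto.comp hlim)
    (tendsto_toCorner (by fun_prop) (by norm_num)) hX.ne' (by norm_num)
  have hY' := tendsto_div_div (m := fun q => mB (q.1, 1 - q.2)) (a := fun q => 3 / 10 - q.1)
    (a₀ := 3 / 10) (s := fun q => q.2) (eventually_toCorner.mono fun q hq => hq.2.1.ne')
    (fun q => by simp only [mB]; ring) ((continuousAt_normB hc).tendsto.comp hlim)
    (tendsto_toCorner (by fun_prop) (by norm_num)) hY.ne' (by norm_num)
  refine hasMinMaxCorner hlim ?_ hc (by simp [vecA, vecB, contrast_dotProduct_contrast])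
    (div_pos hX (by norm_num)) (div_pos hY (by norm_num)) hX' hY' (Or.inl ⟨rfl, rfl⟩)
  filter_upwards [eventually_toCorner] with q hq
  exact mem_domain.2 ⟨hq.1, by linarith [hq.2.2], by simpa using hq.2.1⟩

lemma corner_right_bottom : HasMinMaxCorner (fun q => eigSmall (3 / 10 - q.1, 3 / 5 + q.2))
    (fun q => eigLarge (3 / 10 - q.1, 3 / 5 + q.2)) := by
  have hlim : Tendsto (fun q : ℝ × ℝ => (3 / 10 - q.1, 3 / 5 + q.2)) toCorner
      (𝓝 (3 / 10, 3 / 5)) := tendsto_toCorner (by fun_prop) (by norm_num)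
  have hc : ((3 / 10 : ℝ), (3 / 5 : ℝ)) ∈ closedDomain := mem_closedDomain.2 (by norm_num)
  have hX := normA_pos hc
  have hY := normB_pos hc
  have hX' := tendsto_div_div (m := fun q => mA (3 / 10 - q.1, 3 / 5 + q.2))
    (a := fun q => 3 / 10 - q.1) (a₀ := 3 / 10) (s := fun q => q.2)
    (eventually_toCorner.mono fun q hq => hq.2.1.ne')
    (fun q => by simp only [mA]; ring) ((continuousAt_normA hc).tendsto.comp hlim)
    (tendsto_toCorner (by fun_prop) (by norm_num)) hX.ne' (by norm_num)
  have hY' := tendsto_div_div (m := fun q => mB (3 / 10 - q.1, 3 / 5 + q.2))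
    (a := fun q => 2 / 5 - q.2) (a₀ := 2 / 5) (s := fun q => q.1)
    (eventually_toCorner.mono fun q hq => hq.1.1.ne')
    (fun q => by simp only [mB]; ring) ((continuousAt_normB hc).tendsto.comp hlim)
    (tendsto_toCorner (by fun_prop) (by norm_num)) hY.ne' (by norm_num)
  -- here `mB` is the factor of order `μ` and `mA` the one of order `ν`
  refine hasMinMaxCorner hlim ?_ hc (by simp [vecA, vecB, contrast_dotProduct_contrast])
    (div_pos hY (by norm_num)) (div_pos hX (by norm_num)) hX' hY' (Or.inr ⟨rfl, rfl⟩)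
  filter_upwards [eventually_toCorner] with q hq
  exact mem_domain.2 ⟨⟨by linarith [hq.1.2], by simpa using hq.1.1⟩, by simpa using hq.2.1,
    by linarith [hq.2.2]⟩

end LDAHessian

theorem mainTheorem4 :
    (∀ p ∈ LDAHessian.domain, ContDiffAt ℝ 2 LDAHessian.g (LDAHessian.k p)) ∧
    ∃ eig₁ eig₂ : ℝ × ℝ → ℝ,
      -- the eigenvalues of the Hessian, with multiplicity
      (∀ p ∈ LDAHessian.domain,
        (LDAHessian.H p).charpoly.roots = {0, 0, eig₁ p, eig₂ p} ∧ eig₁ p ≤ eig₂ p) ∧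
      -- continuous, negative and bounded away from zero
      ContinuousOn eig₁ LDAHessian.domain ∧
      ContinuousOn eig₂ LDAHessian.domain ∧
      (∃ c > 0, ∀ p ∈ LDAHessian.domain, eig₁ p ≤ -c ∧ eig₂ p ≤ -c) ∧
      -- the edges u = 0, u = 3/10, v = 3/5 and v = 1
      (LDAHessian.HasEdgeLimit (fun p => p.1 * eig₁ p) (Ioo (3 / 5) 1) (fun v => (0, v)) ∧
        LDAHessian.HasEdgeLimit eig₂ (Ioo (3 / 5) 1) (fun v => (0, v))) ∧
      (LDAHessian.HasEdgeLimit (fun p => (3 / 10 - p.1) * eig₁ p) (Ioo (3 / 5) 1)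
          (fun v => (3 / 10, v)) ∧
        LDAHessian.HasEdgeLimit eig₂ (Ioo (3 / 5) 1) (fun v => (3 / 10, v))) ∧
      (LDAHessian.HasEdgeLimit (fun p => (p.2 - 3 / 5) * eig₁ p) (Ioo 0 (3 / 10))
          (fun u => (u, 3 / 5)) ∧
        LDAHessian.HasEdgeLimit eig₂ (Ioo 0 (3 / 10)) (fun u => (u, 3 / 5))) ∧
      (LDAHessian.HasEdgeLimit (fun p => (1 - p.2) * eig₁ p) (Ioo 0 (3 / 10))
          (fun u => (u, 1)) ∧
        LDAHessian.HasEdgeLimit eig₂ (Ioo 0 (3 / 10)) (fun u => (u, 1))) ∧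
      -- the corners (0, 3/5), (3/10, 1), (0, 1) and (3/10, 3/5)
      LDAHessian.HasProductCorner (fun q => eig₁ (q.1, 3 / 5 + q.2))
        (fun q => eig₂ (q.1, 3 / 5 + q.2)) ∧
      LDAHessian.HasProductCorner (fun q => eig₁ (3 / 10 - q.1, 1 - q.2))
        (fun q => eig₂ (3 / 10 - q.1, 1 - q.2)) ∧
      LDAHessian.HasMinMaxCorner (fun q => eig₁ (q.1, 1 - q.2))
        (fun q => eig₂ (q.1, 1 - q.2)) ∧
      LDAHessian.HasMinMaxCorner (fun q => eig₁ (3 / 10 - q.1, 3 / 5 + q.2))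
        (fun q => eig₂ (3 / 10 - q.1, 3 / 5 + q.2)) := by
  refine ⟨fun p hp => LDAHessian.contDiffAt_g hp, LDAHessian.eigSmall, LDAHessian.eigLarge,
    fun p hp => ⟨LDAHessian.roots_charpoly_H hp, LDAHessian.eigSmall_le_eigLarge hp⟩,
    fun p hp => (LDAHessian.continuousAt_eigSmall hp).continuousWithinAt,
    fun p hp => (LDAHessian.continuousAt_eigLarge (LDAHessian.domain_subset_closedDomain hp)
      (Or.inl (LDAHessian.mA_pos hp))).continuousWithinAt, ?_,
    ⟨LDAHessian.edge_left_eigSmall, ?_⟩, ⟨LDAHessian.edge_right_eigSmall, ?_⟩,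
    ⟨LDAHessian.edge_bottom_eigSmall, ?_⟩, ⟨LDAHessian.edge_top_eigSmall, ?_⟩,
    LDAHessian.corner_left_bottom, LDAHessian.corner_right_top, LDAHessian.corner_left_top,
    LDAHessian.corner_right_bottom⟩
  · obtain ⟨c, hc, hle⟩ := LDAHessian.exists_eigLarge_le
    exact ⟨c, hc, fun p hp => ⟨(LDAHessian.eigSmall_le_eigLarge hp).trans (hle p hp), hle p hp⟩⟩
  · exact LDAHessian.hasEdgeLimit_eigLarge (by fun_prop) fun t ht =>
      (LDAHessian.edge_left ht).imp_right Or.inr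
  · exact LDAHessian.hasEdgeLimit_eigLarge (by fun_prop) fun t ht =>
      (LDAHessian.edge_right ht).imp_right Or.inl
  · exact LDAHessian.hasEdgeLimit_eigLarge (by fun_prop) fun t ht =>
      (LDAHessian.edge_bottom ht).imp_right Or.inr
  · exact LDAHessian.hasEdgeLimit_eigLarge (by fun_prop) fun t ht =>
      (LDAHessian.edge_top ht).imp_right Or.inl
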